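/- Let $\mathcal H_A=\mathcal H_B=(\mathbb C^2)^{\otimes 2}$. Put $P_0=|00\rangle\langle 00|+|11\rangle\langle 11|$ and $P_1=I_4-P_0$. For $\beta\in[0,1]$ let $\mathcal N_\beta$ be the channel given on density operators of $(\mathbb C^2)^{\otimes 2}$ by $$\mathcal N_\beta(\rho)=(1-\beta)\operatorname{Tr}(P_0\rho)\tfrac{P_0}{2}+(1-\beta)\operatorname{Tr}(P_1\rho)\tfrac{P_1}{2}+\beta\tfrac{I_4}{4}$$ and extended linearly, and let $\mathcal E'=\mathcal N_0\otimes\mathcal N_{1/2}$. For $s\in\mathbb R$ let $\mathbb H_s$ be the set of pure states (density operators of rank one) on $\mathcal H_A\otimes\mathcal H_B$ whose entanglement entropy, i.e. the von Neumann entropy $-\operatorname{Tr}(\rho_A\log\rho_A)$ (natural logarithm) of the reduced state $\rho_A=\operatorname{Tr}_B\rho$, is at least $s$. The mechanism $\mathcal E'$ is called $\varepsilon$-private on $\mathbb H_s$ (against local measurement adversaries) if for all finite outcome sets $O_A,O_B$, all POVMs $\{M_a\}_{a\in O_A}$ on $\mathcal H_A$ and $\{M_b\}_{b\in O_B}$ on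 $\mathcal H_B$, all $\rho,\rho'\in\mathbb H_s$ and all $T\subseteq O_A\times O_B$, $$\sum_{(a,b)\in T}\operatorname{Tr}\big((M_a\otimes M_b)\,\mathcal E'(\rho)\big)\le e^{\varepsilon}\sum_{(a,b)\in T}\operatorname{Tr}\big((M_a\otimes M_b)\,\mathcal E'(\rho')\big).$$ The optimal leakage level $\varepsilon^*(s)$ is the infimum of all real $\varepsilon$ for which $\mathcal E'$ is $\varepsilon$-private on $\mathbb H_s$, and $\varepsilon^*(s)=+\infty$ if there is no such $\varepsilon$. **Proposition.** 1. If $s\le\log 2$, then $\varepsilon^*(s)=+\infty$. (For $s=0$ this says that $\mathcal E'$ is not private when no entanglement is required.) 2. If $\log 2<s\le\log 4$ (note that $\log 4$ is the largest possible entanglement entropy), then there is exactly one $\tau=\tau(s)\in[1/2,1]$ with $$s=\log 2-\tau\log\tau-(1-\tau)\log(1-\tau)\qquad(0\log 0:=0),$$ it satisfies $\tau<1$, and $$\varepsilon^*(s)\le\log\frac{3\tau}{1-\tau}<\infty .$$ Moreover $\tau(s)$ is strictly decreasing in $s$ on $(\log 2,\log 4]$. -/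

import Mathlib

noncomputable section

namespace QLDP

open scoped Kronecker ComplexOrder

/-! ### States, reduced states, entropy -/

section States

variable {m n : Type*} [Fintype n]

/-- A density operator: positive semidefinite with unit trace. -/
def IsDensity (ρ : Matrix n n ℂ) : Prop :=
  ρ.PosSemidef ∧ ρ.trace = 1

/-- The partial trace over the second tensor factor. -/
def partialTraceB (ρ : Matrix (m × n) (m × n) ℂ) : Matrix m m ℂ :=
  Matrix.of fun i j => ∑ k, ρ (i, k) (j, k)

theorem partialTraceB_isHermitian {ρ : Matrix (m × n) (m × n) ℂ} (h : ρ.IsHermitian) :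
    (partialTraceB ρ).IsHermitian := by
  ext i j
  simp only [partialTraceB, Matrix.conjTranspose_apply, Matrix.of_apply, star_sum]
  exact Finset.sum_congr rfl fun k _ => h.apply _ _

/-- The von Neumann entropy `- ∑ λⱼ log λⱼ` (natural logarithm, `0 log 0 = 0`) over the
eigenvalues of a Hermitian matrix, counted with multiplicity. -/
def vonNeumannEntropy [DecidableEq n] (ρ : Matrix n n ℂ) (h : ρ.IsHermitian) : ℝ :=
  ∑ j, Real.negMulLog (h.eigenvalues j)

/-- The entanglement entropy of a bipartite state: the entropy of its reduced state on the
first factor. -/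
def entanglementEntropy [Fintype m] [DecidableEq m] (ρ : Matrix (m × n) (m × n) ℂ) (h : ρ.IsHermitian) : ℝ :=
  vonNeumannEntropy (partialTraceB ρ) (partialTraceB_isHermitian h)

/-- The domain `ℍ_s`: bipartite pure states (density operators of rank one) whose entanglement
entropy is at least `s`. -/
def entangledDomain (m n : Type*) [Fintype m] [Fintype n] [DecidableEq m] (s : ℝ) :
    Set (Matrix (m × n) (m × n) ℂ) :=
  {ρ | ∃ h : IsDensity ρ, ρ.rank = 1 ∧ s ≤ entanglementEntropy ρ h.1.isHermitian}

end States

/-! ### Product maps -/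

section Product

variable {m n : Type*} [Fintype m] [Fintype n] [DecidableEq m] [DecidableEq n]

/-- The tensor product `Φ ⊗ Ψ` of two linear maps on matrices, defined on matrix units
by `E_{ij} ⊗ E_{kl} ↦ Φ(E_{ij}) ⊗ Ψ(E_{kl})` and extended linearly. -/
def tensorMap (Φ : Matrix m m ℂ →ₗ[ℂ] Matrix m m ℂ) (Ψ : Matrix n n ℂ →ₗ[ℂ] Matrix n n ℂ) :
    Matrix (m × n) (m × n) ℂ →ₗ[ℂ] Matrix (m × n) (m × n) ℂ where
  toFun ρ := ∑ i, ∑ j, ∑ k, ∑ l,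
    ρ (i, k) (j, l) • (Φ (Matrix.single i j 1) ⊗ₖ Ψ (Matrix.single k l 1))
  map_add' ρ σ := by
    simp only [Matrix.add_apply, add_smul, Finset.sum_add_distrib]
  map_smul' c ρ := by
    simp only [Matrix.smul_apply, smul_eq_mul, mul_smul, Finset.smul_sum, RingHom.id_apply]

/-- The defining property of the tensor product of maps. -/
theorem tensorMap_kronecker (Φ : Matrix m m ℂ →ₗ[ℂ] Matrix m m ℂ)
    (Ψ : Matrix n n ℂ →ₗ[ℂ] Matrix n n ℂ) (X : Matrix m m ℂ) (Y : Matrix n n ℂ) :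
    tensorMap Φ Ψ (X ⊗ₖ Y) = Φ X ⊗ₖ Ψ Y := by
  have hX : Φ X = ∑ i, ∑ j, X i j • Φ (Matrix.single i j 1) := by
    refine (congrArg Φ (Matrix.matrix_eq_sum_single X)).trans ?_
    simp only [map_sum]
    refine Finset.sum_congr rfl fun i _ => Finset.sum_congr rfl fun j _ => ?_
    rw [← map_smul, Matrix.smul_single, smul_eq_mul, mul_one]
  have hY : Ψ Y = ∑ k, ∑ l, Y k l • Ψ (Matrix.single k l 1) := by
    refine (congrArg Ψ (Matrix.matrix_eq_sum_single Y)).trans ?_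
    simp only [map_sum]
    refine Finset.sum_congr rfl fun i _ => Finset.sum_congr rfl fun j _ => ?_
    rw [← map_smul, Matrix.smul_single, smul_eq_mul, mul_one]
  rw [hX, hY]
  ext ⟨a, b⟩ ⟨c, d⟩
  simp only [tensorMap, LinearMap.coe_mk, AddHom.coe_mk, Matrix.sum_apply, Matrix.smul_apply,
    Matrix.kroneckerMap_apply, smul_eq_mul, Finset.sum_mul]
  refine Finset.sum_congr rfl fun i _ => Finset.sum_congr rfl fun j _ => ?_
  simp only [Finset.mul_sum]
  refine Finset.sum_congr rfl fun k _ => Finset.sum_congr rfl fun l _ => ?_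
  ring

end Product

/-! ### Local measurements and privacy -/

/-- A positive operator-valued measurement with outcomes in `O`. -/
structure POVM (O n : Type*) [Fintype O] [Fintype n] [DecidableEq n] where
  /-- The element of the measurement belonging to an outcome. -/
  elem : O → Matrix n n ℂ
  posSemidef : ∀ o, (elem o).PosSemidef
  sum_eq_one : ∑ o, elem o = 1

section Privacy

variable {m n : Type*} [Fintype m] [Fintype n] [DecidableEq m] [DecidableEq n]

/-- The probability that the product measurement `{M_a ⊗ M_b}` on the state `σ` has its
outcome in `T`. -/
def localProb {OA OB : Type*} [Fintype OA] [Fintype OB] (MA : POVM OA m) (MB : POVM OB n)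
    (σ : Matrix (m × n) (m × n) ℂ) (T : Finset (OA × OB)) : ℝ :=
  ∑ o ∈ T, (((MA.elem o.1 ⊗ₖ MB.elem o.2) * σ).trace).re

/-- `ε`-quantum local differential privacy against local measurement adversaries on the
entanglement-constrained domain `ℍ_s`. -/
def IsECLMPrivate (E : Matrix (m × n) (m × n) ℂ →ₗ[ℂ] Matrix (m × n) (m × n) ℂ)
    (s ε : ℝ) : Prop :=
  ∀ (OA OB : Type) [Fintype OA] [Fintype OB] (MA : POVM OA m) (MB : POVM OB n),
    ∀ ρ ∈ entangledDomain m n s, ∀ ρ' ∈ entangledDomain m n s, ∀ T : Finset (OA × OB),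
      localProb MA MB (E ρ) T ≤ Real.exp ε * localProb MA MB (E ρ') T

/-- The optimal leakage level `ε*(s)`: the infimum, in the extended reals, of all `ε` for which
the mechanism is `ε`-private on `ℍ_s`. It is `⊤` when there is no such `ε`. -/
def optimalLeakage (E : Matrix (m × n) (m × n) ℂ →ₗ[ℂ] Matrix (m × n) (m × n) ℂ)
    (s : ℝ) : EReal :=
  sInf ((fun ε : ℝ => (ε : EReal)) '' {ε : ℝ | IsECLMPrivate E s ε})

end Privacy

/-! ### The block-depolarizing mechanism on two qubits -/

/-- Index set of the computational basis of two qubits. -/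
abbrev TwoQubit : Type := Fin 2 × Fin 2

/-- The projector `|00⟩⟨00| + |11⟩⟨11|` onto the even subspace. -/
def P0 : Matrix TwoQubit TwoQubit ℂ :=
  Matrix.single (0, 0) (0, 0) 1 + Matrix.single (1, 1) (1, 1) 1

/-- The projector onto the odd subspace. -/
def P1 : Matrix TwoQubit TwoQubit ℂ := 1 - P0

/-- The block-depolarizing map
`ρ ↦ (1-β) Tr(P₀ρ) P₀/2 + (1-β) Tr(P₁ρ) P₁/2 + β Tr(ρ) I/4`, as a linear map on all matrices;
`Tr(ρ) = 1` on density operators. -/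
def blockDepolarizing (β : ℝ) :
    Matrix TwoQubit TwoQubit ℂ →ₗ[ℂ] Matrix TwoQubit TwoQubit ℂ where
  toFun ρ := ((1 - (β : ℂ)) * (P0 * ρ).trace / 2) • P0
    + ((1 - (β : ℂ)) * (P1 * ρ).trace / 2) • P1 + ((β : ℂ) * ρ.trace / 4) • 1
  map_add' ρ σ := by
    simp only [Matrix.mul_add, Matrix.trace_add]
    module
  map_smul' c ρ := by
    simp only [Matrix.mul_smul, Matrix.trace_smul, smul_eq_mul, RingHom.id_apply]
    module

/-- The asymmetric product mechanism `𝒩_0 ⊗ 𝒩_{1/2}`. -/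
def asymmetricMechanism :
    Matrix (TwoQubit × TwoQubit) (TwoQubit × TwoQubit) ℂ →ₗ[ℂ]
      Matrix (TwoQubit × TwoQubit) (TwoQubit × TwoQubit) ℂ :=
  tensorMap (blockDepolarizing 0) (blockDepolarizing (1 / 2))

end QLDP

end

/-!
The maps `𝒩_β` are self-adjoint for the trace pairing, so the statistics of a product measurement
`A ⊗ B` can be read off `𝒩_0 A ⊗ 𝒩_β B`. The second factor lies between `(β / 4) Tr B` and
`((2 - β) / 4) Tr B` times the identity, hence up to the ratio `(2 - β) / β` the outcome
probabilities depend only on `𝒩_0 ρ_A`, that is, on the weights `p` and `1 - p` of the two parity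
blocks in the reduced state `ρ_A`.

By the inequalities of Peierls and Jensen the entropy of `ρ_A` is at most `log 2 + h(p)` with `h`
the binary entropy, so an entropy of at least `s > log 2` forces both weights into `[1 - τ, τ]`,
where `τ ≥ 1/2` and `log 2 + h(τ) = s`. For `s ≤ log 2` there are maximally entangled states whose
reduced state is supported in a single parity block, and measuring the parity tells them apart with
certainty.
-/

namespace QLDP

open scoped Finset Kronecker ComplexOrder MatrixOrder
open Matrix Real

/-! ### Entropy and block weights -/

section Entropy

variable {n : Type*} [Fintype n]

theorem map_norm_sq_mem_doublyStochastic [DecidableEq n] {𝕜 : Type*} [RCLike 𝕜]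
    (U : unitaryGroup n 𝕜) :
    (U : Matrix n n 𝕜).map (‖·‖ ^ 2) ∈ doublyStochastic ℝ n := by
  have row_sum (V : unitaryGroup n 𝕜) (i : n) : ∑ j, ‖(V : Matrix n n 𝕜) i j‖ ^ 2 = 1 := by
    have h := congr_fun₂ (Unitary.coe_mul_star_self V) i i
    simp only [mul_apply, Unitary.coe_star, star_apply, one_apply_eq, RCLike.star_def,
      RCLike.mul_conj] at h
    exact_mod_cast h
  refine mem_doublyStochastic_iff_sum.2 ⟨fun i j => sq_nonneg _, row_sum U, fun j => ?_⟩
  simpa only [map_apply, Unitary.coe_star, star_apply, norm_star] using row_sum (star U) j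

theorem diag_re_eq_sum_norm_sq_mul_eigenvalues [DecidableEq n] {𝕜 : Type*} [RCLike 𝕜]
    {A : Matrix n n 𝕜} (h : A.IsHermitian) (i : n) :
    RCLike.re (A i i) =
      ∑ j, ‖(h.eigenvectorUnitary : Matrix n n 𝕜) i j‖ ^ 2 * h.eigenvalues j := by
  suffices A i i = ((∑ j, ‖(h.eigenvectorUnitary : Matrix n n 𝕜) i j‖ ^ 2 * h.eigenvalues j : ℝ) :
      𝕜) by rw [this, RCLike.ofReal_re]
  conv_lhs => rw [h.spectral_theorem, Unitary.conjStarAlgAut_apply, mul_apply]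
  push_cast
  refine Finset.sum_congr rfl fun j _ => ?_
  rw [mul_diagonal, star_apply, ← RCLike.mul_conj, Function.comp_apply, mul_right_comm]
  rfl

/-- Peierls' inequality: in the eigenbasis, the diagonal is obtained from the spectrum by a doubly
stochastic matrix. -/
theorem sum_map_eigenvalues_le_sum_map_diag [DecidableEq n] {𝕜 : Type*} [RCLike 𝕜]
    {A : Matrix n n 𝕜} (h : A.IsHermitian) {s : Set ℝ} {f : ℝ → ℝ} (hf : ConcaveOn ℝ s f)
    (hs : ∀ j, h.eigenvalues j ∈ s) :
    ∑ j, f (h.eigenvalues j) ≤ ∑ i, f (RCLike.re (A i i)) := by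
  set D := (h.eigenvectorUnitary : Matrix n n 𝕜).map (‖·‖ ^ 2)
  have hD : D ∈ doublyStochastic ℝ n := map_norm_sq_mem_doublyStochastic _
  calc ∑ j, f (h.eigenvalues j)
      = ∑ j, (∑ i, D i j) * f (h.eigenvalues j) := by
        simp only [sum_col_of_mem_doublyStochastic hD, one_mul]
    _ = ∑ i, ∑ j, D i j * f (h.eigenvalues j) := by
        simp only [Finset.sum_mul]
        exact Finset.sum_comm
    _ ≤ ∑ i, f (∑ j, D i j * h.eigenvalues j) := Finset.sum_le_sum fun i _ =>
        hf.le_map_sum (fun j _ => nonneg_of_mem_doublyStochastic hD)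
          (sum_row_of_mem_doublyStochastic hD i) fun j _ => hs j
    _ = ∑ i, f (RCLike.re (A i i)) := by
        simp only [diag_re_eq_sum_norm_sq_mul_eigenvalues h]
        rfl

theorem sum_negMulLog_le {ι : Type*} (s : Finset ι) {x : ι → ℝ} (hx : ∀ i ∈ s, 0 ≤ x i) :
    ∑ i ∈ s, negMulLog (x i) ≤ negMulLog (∑ i ∈ s, x i) + (∑ i ∈ s, x i) * log #s := by
  rcases s.eq_empty_or_nonempty with rfl | hs
  · simp
  have hc : (0 : ℝ) < #s := by exact_mod_cast hs.card_pos
  have jensen := concaveOn_negMulLog.le_map_sum (t := s) (w := fun _ => (#s : ℝ)⁻¹) (p := x)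
    (fun _ _ => by positivity) (by simp [hc.ne']) hx
  simp only [smul_eq_mul, ← Finset.mul_sum, negMulLog_mul] at jensen
  rw [← mul_le_mul_iff_right₀ hc, mul_inv_cancel_left₀ hc.ne'] at jensen
  refine jensen.trans_eq ?_
  rw [negMulLog, log_inv]
  field_simp
  ring

theorem sum_negMulLog_le_of_card_fiber_le {κ : Type*} [Fintype κ] [DecidableEq κ] (f : n → κ)
    {d : ℕ} (hd : ∀ k, #{i | f i = k} ≤ d) {x : n → ℝ} (hx : ∀ i, 0 ≤ x i) :
    ∑ i, negMulLog (x i) ≤ ∑ k, negMulLog (∑ i with f i = k, x i) + (∑ i, x i) * log d := by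
  have log_card_le (k : κ) : log #{i | f i = k} ≤ log d := by
    rcases Nat.eq_zero_or_pos #{i | f i = k} with h | h
    · simpa [h] using log_natCast_nonneg d
    · exact log_le_log (by exact_mod_cast h) (by exact_mod_cast hd k)
  rw [← Finset.sum_fiberwise _ f, ← Finset.sum_fiberwise Finset.univ f x, Finset.sum_mul,
    ← Finset.sum_add_distrib]
  refine Finset.sum_le_sum fun k _ => (sum_negMulLog_le _ fun i _ => hx i).trans ?_
  exact add_le_add_right (mul_le_mul_of_nonneg_left (log_card_le k)
    (Finset.sum_nonneg fun i _ => hx i)) _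

theorem vonNeumannEntropy_le_of_card_fiber_le [DecidableEq n] {κ : Type*} [Fintype κ]
    [DecidableEq κ] (f : n → κ) {d : ℕ} (hd : ∀ k, #{i | f i = k} ≤ d)
    {A : Matrix n n ℂ} (h : A.PosSemidef) :
    vonNeumannEntropy A h.isHermitian ≤
      ∑ k, negMulLog (∑ i with f i = k, (A i i).re) + A.trace.re * log d := by
  refine (sum_map_eigenvalues_le_sum_map_diag h.isHermitian concaveOn_negMulLog
    h.eigenvalues_nonneg).trans ?_
  rw [trace, Complex.re_sum]
  exact sum_negMulLog_le_of_card_fiber_le f hd fun i => (Complex.le_def.1 h.diag_nonneg).1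

theorem vonNeumannEntropy_eq_of_eq_diagonal [DecidableEq n] {A : Matrix n n ℂ}
    (h : A.IsHermitian) {d : n → ℝ} (hd : A = diagonal fun i => (d i : ℂ)) :
    vonNeumannEntropy A h = ∑ i, negMulLog (d i) := by
  have roots_eq : A.charpoly.roots = Finset.univ.val.map fun i => (d i : ℂ) := by
    rw [hd, charpoly_diagonal]
    have := Polynomial.roots_multiset_prod_X_sub_C (Finset.univ.val.map fun i => (d i : ℂ))
    rwa [Multiset.map_map] at this
  have := congrArg (fun s => (s.map fun z : ℂ => negMulLog z.re).sum)
    (h.roots_charpoly_eq_eigenvalues.symm.trans roots_eq)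
  rwa [Multiset.map_map, Multiset.map_map] at this

end Entropy

/-! ### Product mechanisms in the Heisenberg picture -/

section TracePairing

variable {𝕜 m n : Type*} [RCLike 𝕜]

theorem trace_mul_nonneg [Fintype n] {A B : Matrix n n 𝕜} (hA : A.PosSemidef)
    (hB : B.PosSemidef) : 0 ≤ (A * B).trace := by
  classical
  obtain ⟨C, rfl⟩ := CStarAlgebra.nonneg_iff_eq_star_mul_self.mp hA.nonneg
  rw [mul_assoc, trace_mul_comm]
  exact (hB.mul_mul_conjTranspose_same C).trace_nonneg

theorem trace_mul_le_trace_mul [Fintype n] {A X Y : Matrix n n 𝕜} (hA : A.PosSemidef)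
    (h : X ≤ Y) : (A * X).trace ≤ (A * Y).trace := by
  rw [← sub_nonneg, ← trace_sub, ← mul_sub]
  exact trace_mul_nonneg hA (le_iff.1 h)

theorem kronecker_le_kronecker_left [Finite m] [Finite n] {A : Matrix m m 𝕜}
    {X Y : Matrix n n 𝕜} (hA : A.PosSemidef) (h : X ≤ Y) : A ⊗ₖ X ≤ A ⊗ₖ Y := by
  have := hA.kronecker (le_iff.1 h)
  rwa [le_iff, sub_eq_iff_eq_add.2 (by rw [← kronecker_add, sub_add_cancel])]

end TracePairing

section PartialTrace

variable {m n : Type*} [Fintype n]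

theorem partialTraceB_posSemidef [Finite m] {ρ : Matrix (m × n) (m × n) ℂ} (h : ρ.PosSemidef) :
    (partialTraceB ρ).PosSemidef := by
  have : partialTraceB ρ = ∑ k, ρ.submatrix (·, k) (·, k) := by
    ext i j
    simp only [partialTraceB, of_apply, Matrix.sum_apply, submatrix_apply]
  rw [this]
  exact posSemidef_sum _ fun k _ => h.submatrix _

variable [Fintype m]

theorem trace_kronecker_one_mul [DecidableEq n] (A : Matrix m m ℂ) (ρ : Matrix (m × n) (m × n) ℂ) :
    ((A ⊗ₖ (1 : Matrix n n ℂ)) * ρ).trace = (A * partialTraceB ρ).trace := by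
  simp only [trace, diag_apply, mul_apply, kroneckerMap_apply, partialTraceB, of_apply,
    Fintype.sum_prod_type, one_apply, mul_ite, mul_one, mul_zero, ite_mul, zero_mul,
    Finset.sum_ite_eq, Finset.mem_univ, if_true, Finset.mul_sum]
  exact Finset.sum_congr rfl fun i _ => Finset.sum_comm

theorem trace_partialTraceB (ρ : Matrix (m × n) (m × n) ℂ) :
    (partialTraceB ρ).trace = ρ.trace := by
  classical
  simpa only [one_kronecker_one, one_mul] using (trace_kronecker_one_mul 1 ρ).symm

theorem isDensity_partialTraceB {ρ : Matrix (m × n) (m × n) ℂ} (h : IsDensity ρ) :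
    IsDensity (partialTraceB ρ) :=
  ⟨partialTraceB_posSemidef h.1, (trace_partialTraceB ρ).trans h.2⟩

end PartialTrace

section TensorMap

variable {m n : Type*} [Fintype m] [Fintype n]

/-- The map `Φ` is self-adjoint for the trace pairing, i.e. it acts in the same way on states
(Schrödinger picture) and on observables (Heisenberg picture). -/
def IsTraceSymmetric (Φ : Matrix n n ℂ →ₗ[ℂ] Matrix n n ℂ) : Prop :=
  ∀ X Y, (X * Φ Y).trace = (Φ X * Y).trace

variable [DecidableEq m] [DecidableEq n]

theorem trace_kronecker_mul_tensorMap {Φ : Matrix m m ℂ →ₗ[ℂ] Matrix m m ℂ}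
    {Ψ : Matrix n n ℂ →ₗ[ℂ] Matrix n n ℂ} (hΦ : IsTraceSymmetric Φ) (hΨ : IsTraceSymmetric Ψ)
    (A : Matrix m m ℂ) (B : Matrix n n ℂ) (ρ : Matrix (m × n) (m × n) ℂ) :
    ((A ⊗ₖ B) * tensorMap Φ Ψ ρ).trace = ((Φ A ⊗ₖ Ψ B) * ρ).trace := by
  suffices traceLinearMap _ ℂ ℂ ∘ₗ LinearMap.mulLeft ℂ (A ⊗ₖ B) ∘ₗ tensorMap Φ Ψ =
      traceLinearMap _ ℂ ℂ ∘ₗ LinearMap.mulLeft ℂ (Φ A ⊗ₖ Ψ B) from LinearMap.congr_fun this ρ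
  refine ext_linearMap _ fun ⟨i, k⟩ ⟨j, l⟩ => LinearMap.ext_ring ?_
  have single_eq : single (i, k) (j, l) (1 : ℂ) = single i j 1 ⊗ₖ single k l 1 := by
    rw [single_kronecker_single, mul_one]
  simp only [LinearMap.comp_apply, singleLinearMap_apply, LinearMap.mulLeft_apply,
    traceLinearMap_apply, single_eq, tensorMap_kronecker, ← mul_kronecker_mul, trace_kronecker,
    hΦ A, hΨ B]

theorem re_trace_kronecker_mul_tensorMap_mem_Icc {Φ : Matrix m m ℂ →ₗ[ℂ] Matrix m m ℂ}
    {Ψ : Matrix n n ℂ →ₗ[ℂ] Matrix n n ℂ} (hΦ : IsTraceSymmetric Φ) (hΨ : IsTraceSymmetric Ψ)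
    {A : Matrix m m ℂ} {B : Matrix n n ℂ} {c d : ℝ} (hA : (Φ A).PosSemidef)
    (hB : Ψ B ∈ Set.Icc (c • 1) (d • 1)) {ρ : Matrix (m × n) (m × n) ℂ} (hρ : ρ.PosSemidef) :
    ((A ⊗ₖ B) * tensorMap Φ Ψ ρ).trace.re ∈
      Set.Icc (c * (A * Φ (partialTraceB ρ)).trace.re)
        (d * (A * Φ (partialTraceB ρ)).trace.re) := by
  have scalar (r : ℝ) : r * (A * Φ (partialTraceB ρ)).trace.re =
      (ρ * (Φ A ⊗ₖ (r • (1 : Matrix n n ℂ)))).trace.re := by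
    rw [hΦ, ← trace_kronecker_one_mul, kronecker_smul, Matrix.mul_smul, trace_smul, trace_mul_comm,
      Complex.smul_re, smul_eq_mul]
  rw [trace_kronecker_mul_tensorMap hΦ hΨ, trace_mul_comm (Φ A ⊗ₖ Ψ B) ρ, scalar, scalar]
  exact ⟨(Complex.le_def.1 (trace_mul_le_trace_mul hρ (kronecker_le_kronecker_left hA hB.1))).1,
    (Complex.le_def.1 (trace_mul_le_trace_mul hρ (kronecker_le_kronecker_left hA hB.2))).1⟩

end TensorMap

section Privacy

variable {m n : Type*} [Fintype m] [Fintype n] [DecidableEq m] [DecidableEq n]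

theorem isECLMPrivate_log_div {E : Matrix (m × n) (m × n) ℂ →ₗ[ℂ] Matrix (m × n) (m × n) ℂ}
    {s c d : ℝ} (hc : 0 < c) (hd : 0 < d)
    (h : ∀ ρ ∈ entangledDomain m n s, ∀ (A : Matrix m m ℂ) (B : Matrix n n ℂ), A.PosSemidef →
      B.PosSemidef → ((A ⊗ₖ B) * E ρ).trace.re ∈
        Set.Icc (c * (A.trace.re * B.trace.re)) (d * (A.trace.re * B.trace.re))) :
    IsECLMPrivate E s (log (d / c)) := by
  intro OA OB _ _ MA MB ρ hρ ρ' hρ' T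
  rw [exp_log (by positivity), localProb, localProb, Finset.mul_sum]
  refine Finset.sum_le_sum fun o _ => ?_
  have hA := MA.posSemidef o.1
  have hB := MB.posSemidef o.2
  set u := (MA.elem o.1).trace.re * (MB.elem o.2).trace.re
  calc ((MA.elem o.1 ⊗ₖ MB.elem o.2) * E ρ).trace.re
      ≤ d * u := (h ρ hρ _ _ hA hB).2
    _ = d / c * (c * u) := by field_simp
    _ ≤ d / c * ((MA.elem o.1 ⊗ₖ MB.elem o.2) * E ρ').trace.re := by
        gcongr
        exact (h ρ' hρ' _ _ hA hB).1

theorem isECLMPrivate_tensorMap {Φ : Matrix m m ℂ →ₗ[ℂ] Matrix m m ℂ}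
    {Ψ : Matrix n n ℂ →ₗ[ℂ] Matrix n n ℂ} (hΦ : IsTraceSymmetric Φ) (hΨ : IsTraceSymmetric Ψ)
    {s a b c d : ℝ} (ha : 0 < a) (hb : 0 < b) (hc : 0 < c) (hd : 0 < d)
    (hpos : ∀ A : Matrix m m ℂ, A.PosSemidef → (Φ A).PosSemidef)
    (hρ : ∀ ρ ∈ entangledDomain m n s, Φ (partialTraceB ρ) ∈ Set.Icc (a • 1) (b • 1))
    (hB : ∀ B : Matrix n n ℂ, B.PosSemidef →
      Ψ B ∈ Set.Icc ((c * B.trace.re) • 1) ((d * B.trace.re) • 1)) :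
    IsECLMPrivate (tensorMap Φ Ψ) s (log (d * b / (c * a))) := by
  refine isECLMPrivate_log_div (by positivity) (by positivity) fun ρ hs A B hA hB' => ?_
  have hBtr : 0 ≤ B.trace.re := (Complex.le_def.1 hB'.trace_nonneg).1
  have trace_smul_one (r : ℝ) : (A * (r • (1 : Matrix m m ℂ))).trace.re = r * A.trace.re := by
    rw [Matrix.mul_smul, mul_one, trace_smul, Complex.smul_re, smul_eq_mul]
  have hlo := (Complex.le_def.1 (trace_mul_le_trace_mul hA (hρ ρ hs).1)).1
  have hhi := (Complex.le_def.1 (trace_mul_le_trace_mul hA (hρ ρ hs).2)).1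
  rw [trace_smul_one] at hlo hhi
  obtain ⟨hlo', hhi'⟩ :=
    re_trace_kronecker_mul_tensorMap_mem_Icc hΦ hΨ (hpos A hA) (hB B hB') hs.1.1
  constructor
  · calc c * a * (A.trace.re * B.trace.re) = c * B.trace.re * (a * A.trace.re) := by ring
      _ ≤ c * B.trace.re * (A * Φ (partialTraceB ρ)).trace.re := by gcongr
      _ ≤ _ := hlo'
  · calc _ ≤ d * B.trace.re * (A * Φ (partialTraceB ρ)).trace.re := hhi'
      _ ≤ d * B.trace.re * (b * A.trace.re) := by gcongr
      _ = d * b * (A.trace.re * B.trace.re) := by ring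

theorem optimalLeakage_eq_top_of_localProb
    {E : Matrix (m × n) (m × n) ℂ →ₗ[ℂ] Matrix (m × n) (m × n) ℂ} {s : ℝ} {OA OB : Type}
    [Fintype OA] [Fintype OB] (MA : POVM OA m) (MB : POVM OB n) {T : Finset (OA × OB)}
    {ρ ρ' : Matrix (m × n) (m × n) ℂ} (hρ : ρ ∈ entangledDomain m n s)
    (hρ' : ρ' ∈ entangledDomain m n s) (hpos : 0 < localProb MA MB (E ρ) T)
    (hzero : localProb MA MB (E ρ') T = 0) : optimalLeakage E s = ⊤ := by
  have not_private : {ε : ℝ | IsECLMPrivate E s ε} = ∅ := by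
    refine Set.eq_empty_of_forall_notMem fun ε hε => hpos.not_ge ?_
    simpa only [hzero, mul_zero] using hε OA OB MA MB ρ hρ ρ' hρ' T
  rw [optimalLeakage, not_private, Set.image_empty, _root_.sInf_empty]

end Privacy

/-! ### Parity blocks of two qubits -/

section Parity

theorem P0_eq_diagonal : P0 = diagonal fun x => if x.1 = x.2 then 1 else 0 := by
  ext ⟨a, b⟩ ⟨c, d⟩
  fin_cases a <;> fin_cases b <;> fin_cases c <;> fin_cases d <;> simp [P0, single, diagonal]

theorem P1_eq_diagonal : P1 = diagonal fun x => if x.1 = x.2 then 0 else 1 := by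
  rw [P1, P0_eq_diagonal, ← diagonal_one, diagonal_sub]
  congr 1
  ext x
  split_ifs <;> simp

theorem P0_posSemidef : P0.PosSemidef := by
  rw [P0_eq_diagonal, posSemidef_diagonal_iff]
  intro x
  split_ifs <;> simp

theorem P1_posSemidef : P1.PosSemidef := by
  rw [P1_eq_diagonal, posSemidef_diagonal_iff]
  intro x
  split_ifs <;> simp

theorem P0_add_P1 : P0 + P1 = 1 := add_sub_cancel P0 1

theorem trace_P0 : P0.trace = 2 := by
  simp only [P0_eq_diagonal, trace_diagonal, Finset.sum_boole]
  rfl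

theorem trace_P1 : P1.trace = 2 := by
  rw [P1, trace_sub, trace_one, trace_P0]
  norm_num [TwoQubit]

theorem P1_mul_P1 : P1 * P1 = P1 := by
  simp [P1_eq_diagonal, diagonal_mul_diagonal]

theorem P0_mul_P1 : P0 * P1 = 0 := by
  rw [P0_eq_diagonal, P1_eq_diagonal, diagonal_mul_diagonal, ← diagonal_zero]
  congr 1
  ext x
  split_ifs <;> simp

/-- The probability `Tr(P₀A)` of the even parity block in the state `A`. -/
def evenWeight (A : Matrix TwoQubit TwoQubit ℂ) : ℝ := (P0 * A).trace.re

/-- The probability `Tr(P₁A)` of the odd parity block in the state `A`. -/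
def oddWeight (A : Matrix TwoQubit TwoQubit ℂ) : ℝ := (P1 * A).trace.re

variable {A : Matrix TwoQubit TwoQubit ℂ}

theorem evenWeight_add_oddWeight (A : Matrix TwoQubit TwoQubit ℂ) :
    evenWeight A + oddWeight A = A.trace.re := by
  rw [evenWeight, oddWeight, ← Complex.add_re, ← trace_add, ← add_mul, P0_add_P1, one_mul]

theorem evenWeight_nonneg (h : A.PosSemidef) : 0 ≤ evenWeight A :=
  (Complex.le_def.1 (trace_mul_nonneg P0_posSemidef h)).1

theorem oddWeight_nonneg (h : A.PosSemidef) : 0 ≤ oddWeight A :=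
  (Complex.le_def.1 (trace_mul_nonneg P1_posSemidef h)).1

theorem evenWeight_eq_sum (A : Matrix TwoQubit TwoQubit ℂ) :
    evenWeight A = ∑ x with x.1 + x.2 = 0, (A x x).re := by
  simp [evenWeight, P0_eq_diagonal, trace, diagonal_mul, Fintype.sum_prod_type, Finset.sum_filter]

theorem oddWeight_eq_sum (A : Matrix TwoQubit TwoQubit ℂ) :
    oddWeight A = ∑ x with x.1 + x.2 = 1, (A x x).re := by
  simp [oddWeight, P1_eq_diagonal, trace, diagonal_mul, Fintype.sum_prod_type, Finset.sum_filter]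

theorem vonNeumannEntropy_le_log_two_add_binEntropy_evenWeight (h : IsDensity A) :
    vonNeumannEntropy A h.1.isHermitian ≤ log 2 + binEntropy (evenWeight A) := by
  have htr : A.trace.re = 1 := by rw [h.2, Complex.one_re]
  have hd (k : Fin 2) : #{x : TwoQubit | x.1 + x.2 = k} ≤ 2 := by
    revert k
    decide
  have hle := vonNeumannEntropy_le_of_card_fiber_le (fun x : TwoQubit => x.1 + x.2) hd h.1
  rwa [Fin.sum_univ_two, ← evenWeight_eq_sum, ← oddWeight_eq_sum,
    eq_sub_of_add_eq' ((evenWeight_add_oddWeight A).trans htr), htr, one_mul, add_comm,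
    ← binEntropy_eq_negMulLog_add_negMulLog_one_sub] at hle

theorem le_of_binEntropy_le_binEntropy {t p : ℝ} (ht : t ∈ Set.Icc 2⁻¹ 1) (hp : p ≤ 1)
    (h : binEntropy t ≤ binEntropy p) : p ≤ t := by
  by_contra! hlt
  exact h.not_gt (binEntropy_strictAntiOn ht ⟨ht.1.trans hlt.le, hp⟩ hlt)

theorem mem_Icc_of_binEntropy_le_binEntropy {t p : ℝ} (ht : t ∈ Set.Icc 2⁻¹ 1)
    (hp : p ∈ Set.Icc 0 1) (h : binEntropy t ≤ binEntropy p) : p ∈ Set.Icc (1 - t) t := by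
  refine ⟨?_, le_of_binEntropy_le_binEntropy ht hp.2 h⟩
  rw [← binEntropy_one_sub p] at h
  linarith [le_of_binEntropy_le_binEntropy ht (by linarith [hp.1]) h]

theorem evenWeight_mem_Icc {t : ℝ} (ht : t ∈ Set.Icc 2⁻¹ 1) (h : IsDensity A)
    (hS : log 2 + binEntropy t ≤ vonNeumannEntropy A h.1.isHermitian) :
    evenWeight A ∈ Set.Icc (1 - t) t := by
  have hsum := evenWeight_add_oddWeight A
  rw [h.2, Complex.one_re] at hsum
  refine mem_Icc_of_binEntropy_le_binEntropy ht ⟨evenWeight_nonneg h.1, ?_⟩ ?_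
  · linarith [oddWeight_nonneg h.1]
  · linarith [vonNeumannEntropy_le_log_two_add_binEntropy_evenWeight h]

theorem oddWeight_mem_Icc {t : ℝ} (ht : t ∈ Set.Icc 2⁻¹ 1) (h : IsDensity A)
    (hS : log 2 + binEntropy t ≤ vonNeumannEntropy A h.1.isHermitian) :
    oddWeight A ∈ Set.Icc (1 - t) t := by
  have hsum := evenWeight_add_oddWeight A
  rw [h.2, Complex.one_re] at hsum
  obtain ⟨hlo, hhi⟩ := evenWeight_mem_Icc ht h hS
  exact ⟨by linarith, by linarith⟩

theorem trace_P0_mul (h : A.PosSemidef) : (P0 * A).trace = evenWeight A :=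
  Complex.ext rfl (Complex.le_def.1 (trace_mul_nonneg P0_posSemidef h)).2.symm

theorem trace_P1_mul (h : A.PosSemidef) : (P1 * A).trace = oddWeight A :=
  Complex.ext rfl (Complex.le_def.1 (trace_mul_nonneg P1_posSemidef h)).2.symm

theorem smul_P0_add_smul_P1_mem_Icc {a b x y : ℝ} (hx : x ∈ Set.Icc a b) (hy : y ∈ Set.Icc a b) :
    x • P0 + y • P1 ∈ Set.Icc (a • (1 : Matrix TwoQubit TwoQubit ℂ)) (b • 1) := by
  have smul_one (r : ℝ) : r • (1 : Matrix TwoQubit TwoQubit ℂ) = r • P0 + r • P1 := by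
    rw [← smul_add, P0_add_P1]
  have h0 := P0_posSemidef.nonneg
  have h1 := P1_posSemidef.nonneg
  rw [smul_one, smul_one]
  exact ⟨add_le_add (smul_le_smul_of_nonneg_right hx.1 h0) (smul_le_smul_of_nonneg_right hy.1 h1),
    add_le_add (smul_le_smul_of_nonneg_right hx.2 h0) (smul_le_smul_of_nonneg_right hy.2 h1)⟩

end Parity

/-! ### Block-depolarizing mechanisms -/

section BlockDepolarizing

theorem blockDepolarizing_apply (β : ℝ) (X : Matrix TwoQubit TwoQubit ℂ) :
    blockDepolarizing β X = ((1 - (β : ℂ)) * (P0 * X).trace / 2) • P0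
      + ((1 - (β : ℂ)) * (P1 * X).trace / 2) • P1 + ((β : ℂ) * X.trace / 4) • 1 :=
  rfl

theorem isTraceSymmetric_blockDepolarizing (β : ℝ) : IsTraceSymmetric (blockDepolarizing β) := by
  intro X Y
  simp only [blockDepolarizing_apply, mul_add, add_mul, trace_add, Matrix.mul_smul,
    Matrix.smul_mul, trace_smul, smul_eq_mul, mul_one, one_mul, trace_mul_comm X]
  ring

theorem blockDepolarizing_one (β : ℝ) : blockDepolarizing β 1 = 1 := by
  rw [blockDepolarizing_apply, mul_one, mul_one, trace_P0, trace_P1, trace_one,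
    mul_div_cancel_right₀ _ two_ne_zero, ← smul_add, P0_add_P1, ← add_smul]
  simp [TwoQubit]

theorem blockDepolarizing_zero_P1 : blockDepolarizing 0 P1 = P1 := by
  simp [blockDepolarizing_apply, P0_mul_P1, P1_mul_P1, trace_P1]

variable {A : Matrix TwoQubit TwoQubit ℂ}

theorem blockDepolarizing_eq_of_posSemidef (β : ℝ) (h : A.PosSemidef) :
    blockDepolarizing β A = ((1 - β) / 2 * evenWeight A + β / 4 * A.trace.re) • P0 +
      ((1 - β) / 2 * oddWeight A + β / 4 * A.trace.re) • P1 := by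
  have trace_eq : A.trace = A.trace.re := Complex.ext rfl (Complex.le_def.1 h.trace_nonneg).2.symm
  rw [blockDepolarizing_apply, trace_P0_mul h, trace_P1_mul h, trace_eq, ← P0_add_P1]
  ext i j
  simp only [Matrix.add_apply, Matrix.smul_apply, smul_eq_mul, Complex.real_smul,
    Complex.ofReal_re]
  push_cast
  ring

theorem blockDepolarizing_mem_Icc {β a b : ℝ} (hβ : β ≤ 1) (h : A.PosSemidef)
    (h0 : evenWeight A ∈ Set.Icc a b) (h1 : oddWeight A ∈ Set.Icc a b) :
    blockDepolarizing β A ∈ Set.Icc (((1 - β) / 2 * a + β / 4 * A.trace.re) • 1)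
      (((1 - β) / 2 * b + β / 4 * A.trace.re) • 1) := by
  have affine {x : ℝ} (hx : x ∈ Set.Icc a b) : (1 - β) / 2 * x + β / 4 * A.trace.re ∈
      Set.Icc ((1 - β) / 2 * a + β / 4 * A.trace.re) ((1 - β) / 2 * b + β / 4 * A.trace.re) := by
    have : 0 ≤ (1 - β) / 2 := by linarith
    exact ⟨by gcongr; exact hx.1, by gcongr; exact hx.2⟩
  rw [blockDepolarizing_eq_of_posSemidef β h]
  exact smul_P0_add_smul_P1_mem_Icc (affine h0) (affine h1)

theorem blockDepolarizing_posSemidef {β : ℝ} (hβ : β ∈ Set.Icc 0 1) (h : A.PosSemidef) :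
    (blockDepolarizing β A).PosSemidef := by
  have h0 := evenWeight_nonneg h
  have h1 := oddWeight_nonneg h
  have htr : 0 ≤ A.trace.re := (Complex.le_def.1 h.trace_nonneg).1
  have hβ' : 0 ≤ (1 - β) / 2 := by linarith [hβ.2]
  have hβ'' : 0 ≤ β / 4 := by linarith [hβ.1]
  rw [blockDepolarizing_eq_of_posSemidef β h]
  exact (P0_posSemidef.smul (by positivity)).add (P1_posSemidef.smul (by positivity))

theorem blockDepolarizing_mem_Icc_trace {β : ℝ} (hβ : β ≤ 1) (h : A.PosSemidef) :
    blockDepolarizing β A ∈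
      Set.Icc ((β / 4 * A.trace.re) • 1) (((2 - β) / 4 * A.trace.re) • 1) := by
  have hsum := evenWeight_add_oddWeight A
  have h0 := evenWeight_nonneg h
  have h1 := oddWeight_nonneg h
  convert blockDepolarizing_mem_Icc hβ h (a := 0) (b := A.trace.re) ⟨h0, by linarith⟩
    ⟨h1, by linarith⟩ using 3 <;> ring

theorem blockDepolarizing_zero_mem_Icc {t : ℝ} (ht : t ∈ Set.Icc 2⁻¹ 1) (h : IsDensity A)
    (hS : log 2 + binEntropy t ≤ vonNeumannEntropy A h.1.isHermitian) :
    blockDepolarizing 0 A ∈ Set.Icc (((1 - t) / 2) • 1) ((t / 2) • 1) := by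
  convert blockDepolarizing_mem_Icc zero_le_one h.1 (evenWeight_mem_Icc ht h hS)
    (oddWeight_mem_Icc ht h hS) using 3 <;> ring

theorem isECLMPrivate_tensorMap_blockDepolarizing {β t : ℝ} (hβ : β ∈ Set.Ioc 0 1)
    (ht : t ∈ Set.Ico 2⁻¹ 1) :
    IsECLMPrivate (tensorMap (blockDepolarizing 0) (blockDepolarizing β)) (log 2 + binEntropy t)
      (log ((2 - β) / β * (t / (1 - t)))) := by
  have hβ0 := hβ.1
  have hβ1 := hβ.2
  have ht0 : 0 < t := (by norm_num : (0 : ℝ) < 2⁻¹).trans_le ht.1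
  have ht1 : 0 < 1 - t := sub_pos.2 ht.2
  have hβ2 : 0 < 2 - β := by linarith
  convert isECLMPrivate_tensorMap (isTraceSymmetric_blockDepolarizing 0)
    (isTraceSymmetric_blockDepolarizing β) (a := (1 - t) / 2) (b := t / 2) (c := β / 4)
    (d := (2 - β) / 4) (by positivity) (by positivity) (by positivity) (by positivity)
    (fun A => blockDepolarizing_posSemidef ⟨le_rfl, zero_le_one⟩)
    (fun ρ ⟨hρ, _, hS⟩ =>
      blockDepolarizing_zero_mem_Icc ⟨ht.1, ht.2.le⟩ (isDensity_partialTraceB hρ) hS)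
    (fun B => blockDepolarizing_mem_Icc_trace hβ1) using 2
  field_simp

end BlockDepolarizing

/-! ### Maximally entangled states -/

section MaximallyEntangled

variable {m n κ : Type*} [Fintype κ] [DecidableEq m] [DecidableEq n]

theorem partialTraceB_vecMulVec_star {m n : Type*} [Fintype n] (W : Matrix m n ℂ) :
    partialTraceB (vecMulVec (fun p : m × n => W p.1 p.2) (star fun p => W p.1 p.2)) = W * Wᴴ := by
  ext i j
  simp [partialTraceB, vecMulVec_apply, mul_apply]

theorem rank_vecMulVec_eq_one {m n R : Type*} [Fintype n] [Field R] {v : m → R} {w : n → R}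
    (h : vecMulVec v w ≠ 0) : (vecMulVec v w).rank = 1 := by
  classical
  refine (rank_vecMulVec_le v w).antisymm (Nat.one_le_iff_ne_zero.2 fun hrank => h ?_)
  rw [rank, Submodule.finrank_eq_zero, LinearMap.range_eq_bot] at hrank
  exact toLin'.map_eq_zero_iff.1 hrank

/-- The maximally entangled state `d⁻¹ ∑ₖₗ |f k, g k⟩⟨f l, g l|` of `d = #κ` levels. -/
noncomputable def maximallyEntangled (f : κ ↪ m) (g : κ ↪ n) : Matrix (m × n) (m × n) ℂ :=
  (Fintype.card κ : ℝ)⁻¹ • vecMulVec (fun p => (∑ k, single (f k) (g k) (1 : ℂ)) p.1 p.2)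
    (star fun p => (∑ k, single (f k) (g k) (1 : ℂ)) p.1 p.2)

theorem partialTraceB_smul {m n : Type*} [Fintype n] (r : ℝ) (ρ : Matrix (m × n) (m × n) ℂ) :
    partialTraceB (r • ρ) = r • partialTraceB ρ := by
  ext i j
  simp [partialTraceB, Finset.mul_sum]

variable [Fintype n]

theorem partialTraceB_maximallyEntangled (f : κ ↪ m) (g : κ ↪ n) :
    partialTraceB (maximallyEntangled f g) =
      (Fintype.card κ : ℝ)⁻¹ • ∑ k, single (f k) (f k) (1 : ℂ) := by
  classical
  have single_mul (k l : κ) : single (f k) (g k) (1 : ℂ) * single (g l) (f l) (1 : ℂ) =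
      if k = l then single (f k) (f k) 1 else 0 := by
    split_ifs with h
    · rw [← h, single_mul_single_same, mul_one]
    · exact single_mul_single_of_ne (h := g.injective.ne h) ..
  rw [maximallyEntangled, partialTraceB_smul, partialTraceB_vecMulVec_star, conjTranspose_sum]
  simp only [conjTranspose_single, star_one, Matrix.sum_mul, Matrix.mul_sum, single_mul,
    Finset.sum_ite_eq', Finset.mem_univ, if_true]

variable [Fintype m]

theorem trace_mul_partialTraceB_maximallyEntangled (f : κ ↪ m) (g : κ ↪ n) (A : Matrix m m ℂ) :
    (A * partialTraceB (maximallyEntangled f g)).trace =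
      (Fintype.card κ : ℝ)⁻¹ • ∑ k, A (f k) (f k) := by
  simp only [partialTraceB_maximallyEntangled, Matrix.mul_smul, Matrix.mul_sum, trace_smul,
    trace_sum, trace_mul_single, MulOpposite.op_one, one_smul]

variable [Nonempty κ]

theorem isDensity_maximallyEntangled (f : κ ↪ m) (g : κ ↪ n) :
    IsDensity (maximallyEntangled f g) := by
  refine ⟨(posSemidef_vecMulVec_self_star _).smul (by positivity), ?_⟩
  rw [← trace_partialTraceB, ← one_mul (partialTraceB _),
    trace_mul_partialTraceB_maximallyEntangled]
  simp

theorem rank_maximallyEntangled (f : κ ↪ m) (g : κ ↪ n) : (maximallyEntangled f g).rank = 1 := by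
  have htr := (isDensity_maximallyEntangled f g).2
  rw [maximallyEntangled, ← smul_vecMulVec] at htr ⊢
  refine rank_vecMulVec_eq_one fun h => ?_
  rw [h, trace_zero] at htr
  exact zero_ne_one htr

theorem entanglementEntropy_maximallyEntangled (f : κ ↪ m) (g : κ ↪ n) :
    entanglementEntropy _ (isDensity_maximallyEntangled f g).1.isHermitian =
      log (Fintype.card κ) := by
  have reduced_eq : partialTraceB (maximallyEntangled f g) = diagonal fun i =>
      (((Set.range f).indicator (fun _ => (Fintype.card κ : ℝ)⁻¹) i : ℝ) : ℂ) := by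
    rw [partialTraceB_maximallyEntangled]
    ext i j
    by_cases hi : i ∈ Set.range f
    · obtain ⟨k, rfl⟩ := hi
      rw [Matrix.smul_apply, Matrix.sum_apply, Fintype.sum_eq_single k fun l hl =>
        single_apply_of_row_ne (f.injective.ne hl) ..]
      simp [single_apply, diagonal_apply]
    · have hne (k : κ) : f k ≠ i := fun h => hi ⟨k, h⟩
      simp [Matrix.sum_apply, diagonal_apply, hi, hne]
  rw [entanglementEntropy, vonNeumannEntropy_eq_of_eq_diagonal _ reduced_eq,
    ← Fintype.sum_of_injective f f.injective (fun _ => negMulLog (Fintype.card κ : ℝ)⁻¹) _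
      (fun i hi => by simp [hi]) (fun k => by simp)]
  simp [negMulLog]

theorem maximallyEntangled_mem_entangledDomain (f : κ ↪ m) (g : κ ↪ n) {s : ℝ}
    (hs : s ≤ log (Fintype.card κ)) : maximallyEntangled f g ∈ entangledDomain m n s :=
  ⟨isDensity_maximallyEntangled f g, rank_maximallyEntangled f g,
    hs.trans_eq (entanglementEntropy_maximallyEntangled f g).symm⟩

end MaximallyEntangled

section Leakage

/-- The projective measurement `{P₀, P₁}` of the parity. -/
def parityPOVM : POVM (Fin 2) TwoQubit where
  elem := ![P0, P1]
  posSemidef := Fin.forall_fin_two.2 ⟨P0_posSemidef, P1_posSemidef⟩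
  sum_eq_one := (Fin.sum_univ_two _).trans P0_add_P1

/-- The measurement with a single outcome. -/
def trivialPOVM (n : Type*) [Fintype n] [DecidableEq n] : POVM Unit n where
  elem _ := 1
  posSemidef _ := PosSemidef.one
  sum_eq_one := Fintype.sum_unique _

theorem localProb_parityPOVM_odd (β : ℝ)
    (ρ : Matrix (TwoQubit × TwoQubit) (TwoQubit × TwoQubit) ℂ) :
    localProb parityPOVM (trivialPOVM TwoQubit)
      (tensorMap (blockDepolarizing 0) (blockDepolarizing β) ρ) {(1, ())} =
        oddWeight (partialTraceB ρ) := by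
  rw [localProb, Finset.sum_singleton]
  change ((P1 ⊗ₖ (1 : Matrix TwoQubit TwoQubit ℂ)) * _).trace.re = _
  rw [trace_kronecker_mul_tensorMap (isTraceSymmetric_blockDepolarizing 0)
    (isTraceSymmetric_blockDepolarizing β), blockDepolarizing_zero_P1, blockDepolarizing_one,
    trace_kronecker_one_mul, oddWeight]

/-- The computational basis of the even (`c = 0`) or odd (`c = 1`) parity block. -/
def parityEmbedding (c : Fin 2) : Fin 2 ↪ TwoQubit :=
  ⟨fun i => (i, i + c), fun _ _ h => congrArg Prod.fst h⟩

theorem oddWeight_maximallyEntangled (c : Fin 2) :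
    oddWeight (partialTraceB (maximallyEntangled (parityEmbedding c) (parityEmbedding 0))) = c := by
  rw [oddWeight, trace_mul_partialTraceB_maximallyEntangled, P1_eq_diagonal]
  fin_cases c <;> simp [parityEmbedding]

theorem optimalLeakage_tensorMap_blockDepolarizing_eq_top (β : ℝ) {s : ℝ} (hs : s ≤ log 2) :
    optimalLeakage (tensorMap (blockDepolarizing 0) (blockDepolarizing β)) s = ⊤ := by
  have hmem (c : Fin 2) : maximallyEntangled (parityEmbedding c) (parityEmbedding 0) ∈
      entangledDomain TwoQubit TwoQubit s :=
    maximallyEntangled_mem_entangledDomain _ _ (by simpa using hs)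
  refine optimalLeakage_eq_top_of_localProb parityPOVM (trivialPOVM TwoQubit) (T := {(1, ())})
    (hmem 1) (hmem 0) ?_ ?_
  · simp [localProb_parityPOVM_odd, oddWeight_maximallyEntangled]
  · simp [localProb_parityPOVM_odd, oddWeight_maximallyEntangled]

end Leakage

/-! ### The inverse of the binary entropy -/

section EntropyThreshold

theorem bijOn_binEntropy : Set.BijOn binEntropy (Set.Icc 2⁻¹ 1) (Set.Icc 0 (log 2)) := by
  refine ⟨fun p hp => ⟨binEntropy_nonneg ?_ hp.2, binEntropy_le_log_two⟩,
    binEntropy_strictAntiOn.injOn, ?_⟩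
  · exact (by norm_num : (0 : ℝ) ≤ 2⁻¹).trans hp.1
  · have := intermediate_value_Icc' (by norm_num : (2⁻¹ : ℝ) ≤ 1) binEntropy_continuous.continuousOn
    rwa [binEntropy_one, binEntropy_two_inv] at this

/-- The larger of the two block weights at which the bound `log 2 + h(p)` on the entropy equals
`s`; only meaningful for `s ∈ [log 2, log 4]`. -/
noncomputable def entropyThreshold (s : ℝ) : ℝ :=
  Function.invFunOn binEntropy (Set.Icc 2⁻¹ 1) (s - log 2)

variable {s : ℝ}

theorem sub_log_two_mem_Ioc (hs : s ∈ Set.Ioc (log 2) (log 4)) :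
    s - log 2 ∈ Set.Ioc 0 (log 2) := by
  have log_four : log 4 = log 2 + log 2 := by
    rw [← log_mul two_ne_zero two_ne_zero]
    norm_num
  exact ⟨sub_pos.2 hs.1, by linarith [hs.2]⟩

theorem binEntropy_entropyThreshold (hs : s ∈ Set.Ioc (log 2) (log 4)) :
    binEntropy (entropyThreshold s) = s - log 2 :=
  Function.invFunOn_eq (bijOn_binEntropy.surjOn (Set.Ioc_subset_Icc_self (sub_log_two_mem_Ioc hs)))

theorem entropyThreshold_mem_Icc (hs : s ∈ Set.Ioc (log 2) (log 4)) :
    entropyThreshold s ∈ Set.Icc 2⁻¹ 1 :=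
  Function.invFunOn_mem (bijOn_binEntropy.surjOn (Set.Ioc_subset_Icc_self (sub_log_two_mem_Ioc hs)))

theorem entropyThreshold_mem_Ico (hs : s ∈ Set.Ioc (log 2) (log 4)) :
    entropyThreshold s ∈ Set.Ico 2⁻¹ 1 := by
  obtain ⟨hlo, hhi⟩ := entropyThreshold_mem_Icc hs
  refine ⟨hlo, hhi.lt_of_ne fun h => (sub_log_two_mem_Ioc hs).1.ne ?_⟩
  rw [← binEntropy_entropyThreshold hs, h, binEntropy_one]

theorem entropyThreshold_strictAntiOn :
    StrictAntiOn entropyThreshold (Set.Ioc (log 2) (log 4)) := by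
  intro s hs s' hs' hlt
  rwa [← binEntropy_strictAntiOn.lt_iff_gt (entropyThreshold_mem_Icc hs)
    (entropyThreshold_mem_Icc hs'), binEntropy_entropyThreshold hs,
    binEntropy_entropyThreshold hs', sub_lt_sub_iff_right]

theorem binEntropy_eq_sub_log_two_iff (hs : s ∈ Set.Ioc (log 2) (log 4)) {t : ℝ}
    (ht : t ∈ Set.Icc 2⁻¹ 1) : binEntropy t = s - log 2 ↔ t = entropyThreshold s := by
  rw [← binEntropy_entropyThreshold hs]
  exact bijOn_binEntropy.injOn.eq_iff ht (entropyThreshold_mem_Icc hs)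

theorem log_two_add_binEntropy (t : ℝ) :
    log 2 + binEntropy t = log 2 - t * log t - (1 - t) * log (1 - t) := by
  rw [binEntropy_eq_negMulLog_add_negMulLog_one_sub, negMulLog, negMulLog]
  ring

theorem optimalLeakage_tensorMap_blockDepolarizing_le {β : ℝ} (hβ : β ∈ Set.Ioc 0 1)
    (hs : s ∈ Set.Ioc (log 2) (log 4)) :
    optimalLeakage (tensorMap (blockDepolarizing 0) (blockDepolarizing β)) s ≤
      (log ((2 - β) / β * (entropyThreshold s / (1 - entropyThreshold s))) : ℝ) := by
  have := isECLMPrivate_tensorMap_blockDepolarizing hβ (entropyThreshold_mem_Ico hs)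
  rw [binEntropy_entropyThreshold hs, add_sub_cancel] at this
  exact sInf_le ⟨_, this, rfl⟩

end EntropyThreshold

end QLDP

theorem mainTheorem7_general {β : ℝ} (hβ : β ∈ Set.Ioc 0 1) :
    (∀ s : ℝ, s ≤ Real.log 2 →
      QLDP.optimalLeakage
        (QLDP.tensorMap (QLDP.blockDepolarizing 0) (QLDP.blockDepolarizing β)) s = ⊤) ∧
    ∃ τ : ℝ → ℝ,
      StrictAntiOn τ (Set.Ioc (Real.log 2) (Real.log 4)) ∧
      ∀ s ∈ Set.Ioc (Real.log 2) (Real.log 4),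
        (∀ t ∈ Set.Icc (1 / 2 : ℝ) 1,
          s = Real.log 2 - t * Real.log t - (1 - t) * Real.log (1 - t) ↔ t = τ s) ∧
        1 / 2 ≤ τ s ∧ τ s < 1 ∧
        QLDP.optimalLeakage
            (QLDP.tensorMap (QLDP.blockDepolarizing 0) (QLDP.blockDepolarizing β)) s ≤
          ((Real.log ((2 - β) / β * (τ s / (1 - τ s))) : ℝ) : EReal) := by
  refine ⟨fun s hs => QLDP.optimalLeakage_tensorMap_blockDepolarizing_eq_top β hs,
    QLDP.entropyThreshold, QLDP.entropyThreshold_strictAntiOn, fun s hs => ⟨fun t ht => ?_, ?_,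
      (QLDP.entropyThreshold_mem_Ico hs).2,
      QLDP.optimalLeakage_tensorMap_blockDepolarizing_le hβ hs⟩⟩
  · rw [one_div] at ht
    rw [← QLDP.log_two_add_binEntropy, ← QLDP.binEntropy_eq_sub_log_two_iff hs ht, eq_comm,
      eq_sub_iff_add_eq']
  · rw [one_div]
    exact (QLDP.entropyThreshold_mem_Ico hs).1

theorem mainTheorem7 :
    (∀ s : ℝ, s ≤ Real.log 2 →
      QLDP.optimalLeakage QLDP.asymmetricMechanism s = ⊤) ∧
    ∃ τ : ℝ → ℝ,
      StrictAntiOn τ (Set.Ioc (Real.log 2) (Real.log 4)) ∧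
      ∀ s ∈ Set.Ioc (Real.log 2) (Real.log 4),
        (∀ t ∈ Set.Icc (1 / 2 : ℝ) 1,
          s = Real.log 2 - t * Real.log t - (1 - t) * Real.log (1 - t) ↔ t = τ s) ∧
        1 / 2 ≤ τ s ∧ τ s < 1 ∧
        QLDP.optimalLeakage QLDP.asymmetricMechanism s ≤
          ((Real.log (3 * τ s / (1 - τ s)) : ℝ) : EReal) := by
  have factor : (2 - 1 / 2) / (1 / 2) = (3 : ℝ) := by norm_num
  simpa only [QLDP.asymmetricMechanism, factor, mul_div_assoc] using
    mainTheorem7_general (β := 1 / 2) (by norm_num)
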